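/- A three-colored partition of $n \ge 0$ is a finite multiset of colored positive integers (parts) $j_R, j_G, j_B$ ($j \ge 1$) whose sizes sum to $n$. Let $\Gamma$ be the set of three-colored partitions in which the sizes of all parts are distinct (for each $j$ there is at most one part in total among $j_R, j_G, j_B$) and in which, for every $j \ge 1$, none of the following eight pairs of parts occurs together: $$j_R + (j+1)_R,\quad j_R + (j+2)_R,\quad j_R + (j+1)_B,\quad j_G + (j+1)_R,$$ $$j_G + (j+2)_R,\quad j_G + (j+1)_B,\quad j_B + (j+1)_R,\quad j_B + (j+1)_G.$$ Let $A(n)$ be the number of three-colored partitions of $n$ that belong to $\Gamma$ and do not contain the part $1_R$. Then, as formal power series in $q$, $$\sum_{n \ge 0} A(n) q^n = \frac{1}{(q;q^2)_\infty \, (q;q^5)_\infty \, (q^4;q^5)_\infty},$$ where $(a;b)_\infty = \prod_{j \ge 1} (1 - a b^{j-1})$. -/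

import Mathlib

/-- The three colors. -/
inductive PartColor where
  | R
  | G
  | B
  deriving DecidableEq

instance PartColor.instFintype : Fintype PartColor where
  elems := {PartColor.R, PartColor.G, PartColor.B}
  complete := by intro c; cases c <;> simp

/-- A three-colored partition of `n`: a finite multiset of colored positive integers `(size, color)`
whose sizes sum to `n`. -/
@[ext]
structure ColoredPartition (n : ℕ) where
  /-- the colored parts, with multiplicity -/
  parts : Multiset (ℕ × PartColor)
  parts_pos : ∀ p ∈ parts, 0 < p.1
  parts_sum : (parts.map Prod.fst).sum = n

/-- Membership in the class `Γ`: all sizes are distinct, and none of the eight forbidden pairs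
occurs. -/
structure ColoredPartition.InGamma {n : ℕ} (π : ColoredPartition n) : Prop where
  distinct : (π.parts.map Prod.fst).Nodup
  not_R_R_one : ∀ j, ¬ ((j, PartColor.R) ∈ π.parts ∧ (j + 1, PartColor.R) ∈ π.parts)
  not_R_R_two : ∀ j, ¬ ((j, PartColor.R) ∈ π.parts ∧ (j + 2, PartColor.R) ∈ π.parts)
  not_R_B_one : ∀ j, ¬ ((j, PartColor.R) ∈ π.parts ∧ (j + 1, PartColor.B) ∈ π.parts)
  not_G_R_one : ∀ j, ¬ ((j, PartColor.G) ∈ π.parts ∧ (j + 1, PartColor.R) ∈ π.parts)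
  not_G_R_two : ∀ j, ¬ ((j, PartColor.G) ∈ π.parts ∧ (j + 2, PartColor.R) ∈ π.parts)
  not_G_B_one : ∀ j, ¬ ((j, PartColor.G) ∈ π.parts ∧ (j + 1, PartColor.B) ∈ π.parts)
  not_B_R_one : ∀ j, ¬ ((j, PartColor.B) ∈ π.parts ∧ (j + 1, PartColor.R) ∈ π.parts)
  not_B_G_one : ∀ j, ¬ ((j, PartColor.B) ∈ π.parts ∧ (j + 1, PartColor.G) ∈ π.parts)

/-- There are finitely many three-colored partitions of `n`, so counting them with `Nat.card` is
meaningful. -/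
instance ColoredPartition.instFinite (n : ℕ) : Finite (ColoredPartition n) := by
  classical
  let M : Multiset (ℕ × PartColor) :=
    n • (Finset.range (n + 1) ×ˢ (Finset.univ : Finset PartColor)).val
  have key : ∀ π : ColoredPartition n, π.parts ≤ M := by
    intro π
    rw [Multiset.le_iff_count]
    intro p
    by_cases hp : p ∈ π.parts
    · have h1 : p.1 ≤ n := by
        have := Multiset.single_le_sum (s := π.parts.map Prod.fst) (fun x _ => Nat.zero_le x) p.1
          (Multiset.mem_map_of_mem _ hp)
        rwa [π.parts_sum] at this
      have h2 : Multiset.count p π.parts ≤ n := by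
        have h3 : (π.parts.map Prod.fst).card • 1 ≤ (π.parts.map Prod.fst).sum := by
          apply Multiset.card_nsmul_le_sum
          intro x hx
          obtain ⟨y, hy, rfl⟩ := Multiset.mem_map.1 hx
          exact π.parts_pos y hy
        rw [π.parts_sum] at h3
        have h4 := Multiset.count_le_card p π.parts
        simp only [Multiset.card_map, smul_eq_mul, mul_one] at h3
        omega
      have h5 : p ∈ Finset.range (n + 1) ×ˢ (Finset.univ : Finset PartColor) := by
        simp only [Finset.mem_product, Finset.mem_range, Finset.mem_univ, and_true]
        omega
      have h6 : 1 ≤ Multiset.count p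
          (Finset.range (n + 1) ×ˢ (Finset.univ : Finset PartColor)).val :=
        Multiset.one_le_count_iff_mem.2 h5
      calc Multiset.count p π.parts ≤ n * 1 := by omega
        _ ≤ n * _ := Nat.mul_le_mul_left n h6
        _ = Multiset.count p M := (Multiset.count_nsmul p n _).symm
    · simp [Multiset.count_eq_zero_of_notMem hp]
  have hfin : (Set.Iic M).Finite := by
    refine (Multiset.finite_toSet M.powerset).subset ?_
    intro s hs
    exact Multiset.mem_powerset.2 hs
  have : Finite (Set.Iic M) := hfin
  refine Finite.of_injective (fun π => (⟨π.parts, key π⟩ : Set.Iic M)) ?_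
  intro a b h
  exact ColoredPartition.ext (congrArg Subtype.val h)

/-- `gammaCount n` is the number of three-colored partitions of `n` in `Γ` without the part `1`
colored `R`. -/
noncomputable def gammaCount (n : ℕ) : ℕ :=
  Nat.card {π : ColoredPartition n // π.InGamma ∧ (1, PartColor.R) ∉ π.parts}

open scoped PowerSeries PowerSeries.WithPiTopology

/-- The infinite `q`-Pochhammer symbol `(a; b)_∞ = ∏_{j ≥ 1} (1 - a b^(j-1))` of formal power
series; the product is a limit in the topology of coefficientwise convergence. -/
noncomputable def qPochhammerInf (a b : ℚ⟦X⟧) : ℚ⟦X⟧ :=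
  ∏' j : ℕ, (1 - a * b ^ j)

/-- The product defining `(q^k; q^m)_∞` converges for `m ≥ 1`. -/
theorem hasProd_qPochhammerInf (k m : ℕ) (hm : 0 < m) :
    HasProd (fun j : ℕ => (1 - PowerSeries.X ^ k * (PowerSeries.X ^ m) ^ j : ℚ⟦X⟧))
      (qPochhammerInf (PowerSeries.X ^ k) (PowerSeries.X ^ m)) := by
  refine Multipliable.hasProd ?_
  simp_rw [sub_eq_add_neg]
  apply PowerSeries.WithPiTopology.multipliable_one_add_of_tendsto_order_atTop_nhds_top
  refine ENat.tendsto_nhds_top_iff_natCast_lt.mpr fun n => Filter.eventually_atTop.mpr ⟨n + 1, ?_⟩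
  intro i hi
  rw [PowerSeries.order_neg, ← pow_mul, ← pow_add, PowerSeries.order_X_pow]
  norm_cast
  nlinarith

/-- For `k, m ≥ 1` the series `(q^k; q^m)_∞` has constant term `1`, hence is invertible. -/
theorem constantCoeff_qPochhammerInf (k m : ℕ) (hk : 0 < k) (hm : 0 < m) :
    PowerSeries.constantCoeff (qPochhammerInf (PowerSeries.X ^ k) (PowerSeries.X ^ m)) = 1 := by
  have h := (hasProd_qPochhammerInf k m hm).map (PowerSeries.constantCoeff (R := ℚ))
    (PowerSeries.WithPiTopology.continuous_constantCoeff ℚ)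
  have h1 : (PowerSeries.constantCoeff (R := ℚ)) ∘
      (fun j : ℕ => (1 - PowerSeries.X ^ k * (PowerSeries.X ^ m) ^ j : ℚ⟦X⟧)) = fun _ => 1 := by
    funext j
    simp [hk.ne']
  rw [h1] at h
  exact h.unique hasProd_one

section QSeries

variable {R : Type*} [CommRing R]

/-- The finite `q`-Pochhammer symbol `(a; q)_n`. -/
def qPoch (a q : R) (n : ℕ) : R := ∏ j ∈ Finset.range n, (1 - a * q ^ j)

/-- The sequence `u` is `n ↦ 1 / (q; q)_n`. -/
structure IsInvQFactorial (q : R) (u : ℕ → R) : Prop where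
  zero : u 0 = 1
  eq_mul_succ : ∀ n, u n = (1 - q ^ (n + 1)) * u (n + 1)

/-- `shiftDown u n m` is `u (n - m)`, with value `0` for `n < m`. -/
def shiftDown (u : ℕ → R) (n m : ℕ) : R := if m ≤ n then u (n - m) else 0

theorem qPoch_zero (a q : R) : qPoch a q 0 = 1 := by simp [qPoch]

theorem qPoch_succ (a q : R) (n : ℕ) : qPoch a q (n + 1) = qPoch a q n * (1 - a * q ^ n) := by
  simp [qPoch, Finset.prod_range_succ]

theorem qPoch_succ' (a q : R) (n : ℕ) :
    qPoch a q (n + 1) = (1 - a) * qPoch (a * q) q n := by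
  simp only [qPoch, Finset.prod_range_succ', pow_zero, mul_one, mul_comm (1 - a)]
  congr 1
  exact Finset.prod_congr rfl fun j _ => by ring

theorem choose_two_succ (n : ℕ) : (n + 1).choose 2 = n + n.choose 2 := by
  rw [Nat.choose_succ_succ' n 1, Nat.choose_one_right]

theorem shiftDown_succ_succ (u : ℕ → R) (n m : ℕ) :
    shiftDown u (n + 1) (m + 1) = shiftDown u n m := by
  simp [shiftDown]

theorem shiftDown_of_lt (u : ℕ → R) {n m : ℕ} (h : n < m) : shiftDown u n m = 0 := by
  simp [shiftDown, h.not_ge]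

theorem shiftDown_add (u : ℕ → R) (n m : ℕ) : shiftDown u (n + m) m = u n := by
  simp [shiftDown]

namespace IsInvQFactorial

variable {q : R} {u : ℕ → R} (hu : IsInvQFactorial q u)
include hu

theorem mul_qPoch (n : ℕ) : u n * qPoch q q n = 1 := by
  induction n with
  | zero => simp [hu.zero, qPoch_zero]
  | succ n ih => rw [← ih, hu.eq_mul_succ n, qPoch_succ]; ring

theorem mul_left_cancel (n : ℕ) {a b : R} (h : u n * a = u n * b) : a = b := by
  have h1 := hu.mul_qPoch n
  calc a = u n * qPoch q q n * a := by rw [h1, one_mul]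
    _ = qPoch q q n * (u n * a) := by ring
    _ = qPoch q q n * (u n * b) := by rw [h]
    _ = u n * qPoch q q n * b := by ring
    _ = b := by rw [h1, one_mul]

theorem one_sub_cancel (n : ℕ) {a b : R} (h : (1 - q ^ (n + 1)) * a = (1 - q ^ (n + 1)) * b) :
    a = b := by
  apply hu.mul_left_cancel n
  rw [hu.eq_mul_succ n]
  linear_combination u (n + 1) * h

/-- The finite `q`-binomial theorem. -/
theorem sum_antidiagonal_qBinomial (z : R) (n : ℕ) :
    ∑ p ∈ Finset.HasAntidiagonal.antidiagonal n, q ^ p.2.choose 2 * z ^ p.2 * u p.1 * u p.2 =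
      u n * qPoch (-z) q n := by
  induction n with
  | zero => simp [hu.zero, qPoch_zero]
  | succ n ih =>
    apply hu.one_sub_cancel n
    have h1 : (1 - q ^ (n + 1)) * ∑ p ∈ Finset.HasAntidiagonal.antidiagonal (n + 1),
        q ^ p.2.choose 2 * z ^ p.2 * u p.1 * u p.2 =
        ∑ p ∈ Finset.HasAntidiagonal.antidiagonal (n + 1),
          q ^ p.2.choose 2 * z ^ p.2 * ((1 - q ^ p.1) * u p.1) * u p.2 +
        ∑ p ∈ Finset.HasAntidiagonal.antidiagonal (n + 1),
          q ^ p.1 * q ^ p.2.choose 2 * z ^ p.2 * u p.1 * ((1 - q ^ p.2) * u p.2) := by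
      rw [Finset.mul_sum, ← Finset.sum_add_distrib]
      refine Finset.sum_congr rfl fun p hp => ?_
      rw [← Finset.HasAntidiagonal.mem_antidiagonal.1 hp, pow_add]
      ring
    rw [h1, Finset.Nat.sum_antidiagonal_succ, Finset.Nat.sum_antidiagonal_succ', qPoch_succ]
    simp only [← hu.eq_mul_succ, pow_zero, sub_self, zero_mul, mul_zero, zero_add]
    have h2 : ∑ p ∈ Finset.HasAntidiagonal.antidiagonal n,
        q ^ p.1 * q ^ (p.2 + 1).choose 2 * z ^ (p.2 + 1) * u p.1 * u p.2 =
        z * q ^ n * ∑ p ∈ Finset.HasAntidiagonal.antidiagonal n, q ^ p.2.choose 2 * z ^ p.2 * u p.1 * u p.2 := by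
      rw [Finset.mul_sum]
      refine Finset.sum_congr rfl fun p hp => ?_
      rw [← Finset.HasAntidiagonal.mem_antidiagonal.1 hp, choose_two_succ]
      ring
    rw [h2, ih]
    linear_combination (qPoch (-z) q n * (1 + z * q ^ n)) * hu.eq_mul_succ n

/-- A finite form of the Durfee rectangle identity. -/
theorem sum_antidiagonal_durfee (j l : ℕ) :
    ∑ p ∈ Finset.HasAntidiagonal.antidiagonal j, q ^ (p.2 * (l - p.1)) * u p.1 * u p.2 * shiftDown u l p.1 =
      u j * u l := by
  induction j generalizing l with
  | zero => simp [hu.zero, shiftDown]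
  | succ n ih =>
    apply hu.one_sub_cancel n
    have h1 : (1 - q ^ (n + 1)) * ∑ p ∈ Finset.HasAntidiagonal.antidiagonal (n + 1),
        q ^ (p.2 * (l - p.1)) * u p.1 * u p.2 * shiftDown u l p.1 =
        ∑ p ∈ Finset.HasAntidiagonal.antidiagonal (n + 1),
          q ^ (p.2 * (l - p.1)) * ((1 - q ^ p.1) * u p.1) * u p.2 * shiftDown u l p.1 +
        ∑ p ∈ Finset.HasAntidiagonal.antidiagonal (n + 1),
          q ^ p.1 * q ^ (p.2 * (l - p.1)) * u p.1 * ((1 - q ^ p.2) * u p.2) *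
            shiftDown u l p.1 := by
      rw [Finset.mul_sum, ← Finset.sum_add_distrib]
      refine Finset.sum_congr rfl fun p hp => ?_
      rw [← Finset.HasAntidiagonal.mem_antidiagonal.1 hp, pow_add]
      ring
    rw [h1, Finset.Nat.sum_antidiagonal_succ, Finset.Nat.sum_antidiagonal_succ']
    simp only [← hu.eq_mul_succ, pow_zero, sub_self, zero_mul, mul_zero, zero_add]
    have h2 : ∑ p ∈ Finset.HasAntidiagonal.antidiagonal n,
        q ^ p.1 * q ^ ((p.2 + 1) * (l - p.1)) * u p.1 * u p.2 * shiftDown u l p.1 =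
        q ^ l * ∑ p ∈ Finset.HasAntidiagonal.antidiagonal n,
          q ^ (p.2 * (l - p.1)) * u p.1 * u p.2 * shiftDown u l p.1 := by
      rw [Finset.mul_sum]
      refine Finset.sum_congr rfl fun p hp => ?_
      by_cases hl : p.1 ≤ l
      · obtain ⟨t, rfl⟩ := Nat.exists_eq_add_of_le hl
        simp only [Nat.add_sub_cancel_left]
        ring
      · rw [shiftDown_of_lt u (not_le.1 hl)]
        simp
    rw [h2, ih]
    cases l with
    | zero =>
      rw [Finset.sum_eq_zero]
      · rw [hu.eq_mul_succ n]; ring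
      · intro p _
        rw [shiftDown_of_lt u (Nat.succ_pos _)]
        simp
    | succ l =>
      simp only [shiftDown_succ_succ, Nat.add_sub_add_right]
      rw [ih, hu.eq_mul_succ l]
      linear_combination u (l + 1) * hu.eq_mul_succ n

/-- One step of the Bailey chain on a single pair `u (N - m) * u (N + m)`. -/
theorem sum_range_bailey (N m : ℕ) :
    ∑ s ∈ Finset.range (N + 1), q ^ (s ^ 2) * u (N - s) * (shiftDown u s m * u (s + m)) =
      q ^ (m ^ 2) * (shiftDown u N m * u (N + m)) := by
  by_cases h : m ≤ N
  · obtain ⟨t, rfl⟩ := Nat.exists_eq_add_of_le' h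
    rw [shiftDown_add, ← hu.sum_antidiagonal_durfee,
      Finset.Nat.sum_antidiagonal_eq_sum_range_succ_mk,
      add_right_comm, add_comm (t + 1) m, Finset.sum_range_add, Finset.mul_sum,
      Finset.sum_eq_zero, zero_add, ← Finset.sum_range_reflect]
    · refine Finset.sum_congr rfl fun k hk => ?_
      obtain ⟨a, rfl⟩ := Nat.exists_eq_add_of_le (Nat.lt_succ_iff.1 (Finset.mem_range.1 hk))
      have e1 : m + (k + a + 1 - 1 - k) = a + m := by omega
      have e2 : k + a - k = a := by omega
      have e3 : k + a + m - (a + m) = k := by omega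
      have e4 : k + a + m + m - k = a + m + m := by omega
      rw [e1, e3, shiftDown_add]
      simp only [e2, e4, shiftDown, if_pos (show k ≤ k + a + m + m by omega)]
      ring
    · intro s hs
      rw [shiftDown_of_lt u (Finset.mem_range.1 hs)]
      ring
  · rw [shiftDown_of_lt u (not_le.1 h), Finset.sum_eq_zero]
    · ring
    · intro s hs
      rw [shiftDown_of_lt u (by have := Finset.mem_range.1 hs; omega)]
      ring

/-- One step of the Bailey chain. -/
theorem sum_range_bailey_sum (c : ℕ → R) (N n : ℕ) :
    ∑ s ∈ Finset.range (N + 1), q ^ (s ^ 2) * u (N - s) *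
        ∑ m ∈ Finset.range n, c m * (shiftDown u s m * u (s + m)) =
      ∑ m ∈ Finset.range n, q ^ (m ^ 2) * c m * (shiftDown u N m * u (N + m)) := by
  simp_rw [Finset.mul_sum]
  rw [Finset.sum_comm]
  refine Finset.sum_congr rfl fun m _ => ?_
  rw [mul_comm (q ^ m ^ 2), mul_assoc, ← hu.sum_range_bailey N m, Finset.mul_sum]
  exact Finset.sum_congr rfl fun s _ => by ring

end IsInvQFactorial

/-- The coefficients `(-1)^m z^m Q^(m(m-1)/2)` of the Jacobi triple product, folded along
`m ↦ -m`; here `z * w = Q`. -/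
def thetaCoeff (z w Q : R) (m : ℕ) : R :=
  if m = 0 then 1 else (-1) ^ m * (z ^ m + w ^ m) * Q ^ m.choose 2

theorem thetaCoeff_zero (z w Q : R) : thetaCoeff z w Q 0 = 1 := by simp [thetaCoeff]

theorem thetaCoeff_succ (z w Q : R) (m : ℕ) : thetaCoeff z w Q (m + 1) =
    (-1) ^ (m + 1) * (z ^ (m + 1) + w ^ (m + 1)) * Q ^ (m + 1).choose 2 := by
  simp [thetaCoeff]

namespace IsInvQFactorial

variable {q : R} {u : ℕ → R} (hu : IsInvQFactorial q u)
include hu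

theorem shiftDown_succ (n m : ℕ) (h : m ≤ n) :
    shiftDown u n (m + 1) = (1 - q ^ (n - m)) * u (n - m) := by
  obtain ⟨t, rfl⟩ := Nat.exists_eq_add_of_le' h
  rw [Nat.add_sub_cancel]
  cases t with
  | zero => rw [shiftDown_of_lt u (by omega)]; simp
  | succ t => rw [← hu.eq_mul_succ, add_right_comm, add_assoc, shiftDown_add]

theorem sum_thetaCoeff_one_aux (s n : ℕ) :
    (1 - q ^ s) * ∑ m ∈ Finset.range (n + 1), thetaCoeff 1 q q m * (shiftDown u s m * u (s + m)) =
      (-1) ^ n * q ^ (n + 1).choose 2 * shiftDown u s (n + 1) * u (s + n) := by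
  induction n with
  | zero =>
    rw [hu.shiftDown_succ s 0 (Nat.zero_le _)]
    simp [thetaCoeff_zero, shiftDown]
    ring
  | succ n ih =>
    rw [Finset.sum_range_succ, mul_add, ih, thetaCoeff_succ, choose_two_succ (n + 1)]
    by_cases h : n + 1 ≤ s
    · rw [hu.shiftDown_succ s (n + 1) h, hu.eq_mul_succ (s + n)]
      obtain ⟨t, rfl⟩ := Nat.exists_eq_add_of_le' h
      rw [shiftDown_add, Nat.add_sub_cancel, one_pow, ← add_assoc (t + (n + 1)) n 1]
      ring
    · rw [shiftDown_of_lt u (by omega), shiftDown_of_lt u (by omega)]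
      ring

theorem sum_thetaCoeff_one (s n : ℕ) (h : s ≤ n) :
    ∑ m ∈ Finset.range (n + 1), thetaCoeff 1 q q m * (shiftDown u s m * u (s + m)) =
      if s = 0 then 1 else 0 := by
  cases s with
  | zero =>
    rw [Finset.sum_range_succ', Finset.sum_eq_zero]
    · simp [thetaCoeff_zero, shiftDown, hu.zero]
    · intro m _
      rw [shiftDown_of_lt u (by omega)]
      ring
  | succ s =>
    apply hu.one_sub_cancel s
    rw [hu.sum_thetaCoeff_one_aux, shiftDown_of_lt u (by omega)]
    simp

/-- A finite form of the first Rogers-Ramanujan identity, before the triple product is applied. -/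
theorem sum_range_rogersRamanujan (N : ℕ) :
    ∑ s ∈ Finset.range (N + 1), q ^ (s ^ 2) * u (N - s) * u s =
      ∑ m ∈ Finset.range (N + 1),
        q ^ (2 * m ^ 2) * thetaCoeff 1 q q m * (shiftDown u N m * u (N + m)) := by
  have h1 : ∀ s n, s ≤ n → ∑ m ∈ Finset.range (n + 1),
      q ^ (m ^ 2) * thetaCoeff 1 q q m * (shiftDown u s m * u (s + m)) = u s := by
    intro s n hs
    rw [← hu.sum_range_bailey_sum, Finset.sum_range_succ', Finset.sum_eq_zero]
    · rw [hu.sum_thetaCoeff_one 0 n (Nat.zero_le _)]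
      simp
    · intro t ht
      rw [hu.sum_thetaCoeff_one _ n (by have := Finset.mem_range.1 ht; omega)]
      simp
  have h2 := hu.sum_range_bailey_sum (fun m => q ^ (m ^ 2) * thetaCoeff 1 q q m) N (N + 1)
  rw [Finset.sum_congr rfl fun s hs => by
    rw [h1 s N (Nat.lt_succ_iff.1 (Finset.mem_range.1 hs))]] at h2
  rw [h2]
  exact Finset.sum_congr rfl fun m _ => by ring

theorem shiftDown_mul_three_term (N m : ℕ) :
    (1 - q ^ (2 * N + 1)) * (1 - q ^ (2 * N + 2)) *
        (shiftDown u (N + 1) (m + 1) * u (N + 1 + (m + 1))) * q ^ m =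
      (1 + q ^ (2 * N + 1)) * (shiftDown u N (m + 1) * u (N + (m + 1))) * q ^ m
      + q ^ N * (shiftDown u N m * u (N + m))
      + q ^ (N + 2 * m + 2) * (shiftDown u N (m + 2) * u (N + (m + 2))) := by
  rcases lt_or_ge N m with h | h
  · rw [shiftDown_succ_succ, shiftDown_of_lt u h, shiftDown_of_lt u (by omega : N < m + 1),
      shiftDown_of_lt u (by omega : N < m + 2)]
    ring
  · obtain ⟨t, rfl⟩ := Nat.exists_eq_add_of_le' h
    rw [shiftDown_succ_succ, hu.shiftDown_succ _ m h, shiftDown_add, Nat.add_sub_cancel]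
    have e : shiftDown u (t + m) (m + 2) = (1 - q ^ (t - 1)) * ((1 - q ^ t) * u t) := by
      cases t with
      | zero => rw [shiftDown_of_lt u (by omega)]; simp
      | succ t =>
        rw [hu.shiftDown_succ _ (m + 1) (by omega), show t + 1 + m - (m + 1) = t by omega,
          Nat.add_sub_cancel, hu.eq_mul_succ t]
    have e1 := hu.eq_mul_succ (t + 2 * m)
    have e2 := hu.eq_mul_succ (t + 2 * m + 1)
    rw [e, show t + m + 1 + (m + 1) = t + 2 * m + 1 + 1 by ring,
      show t + m + (m + 1) = t + 2 * m + 1 by ring, show t + m + m = t + 2 * m by ring,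
      show t + m + (m + 2) = t + 2 * m + 1 + 1 by ring, e1, e2]
    cases t with
    | zero => ring
    | succ t =>
      rw [Nat.add_sub_cancel]
      ring

theorem shiftDown_mul_three_term_zero (N : ℕ) :
    (1 - q ^ (2 * N + 1)) * (1 - q ^ (2 * N + 2)) * (shiftDown u (N + 1) 0 * u (N + 1)) =
      (1 + q ^ (2 * N + 1)) * (shiftDown u N 0 * u N)
      + 2 * q ^ (N + 1) * (shiftDown u N 1 * u (N + 1)) := by
  rw [hu.shiftDown_succ N 0 (Nat.zero_le _)]
  simp only [shiftDown, Nat.zero_le, if_true, Nat.sub_zero]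
  rw [hu.eq_mul_succ N]
  ring

theorem sum_thetaCoeff_aux {z w : R} (hzw : z * w = q) (N n : ℕ) :
    (1 - q ^ (2 * N + 1)) * (1 - q ^ (2 * N + 2)) *
        ∑ m ∈ Finset.range (n + 1),
          thetaCoeff z w q m * (shiftDown u (N + 1) m * u (N + 1 + m)) =
      (1 - z * q ^ N) * (1 - w * q ^ N) *
        ∑ m ∈ Finset.range (n + 1), thetaCoeff z w q m * (shiftDown u N m * u (N + m)) +
      (-1) ^ n * q ^ (N + n.choose 2) *
        ((z ^ (n + 1) + w ^ (n + 1)) * (shiftDown u N n * u (N + n)) +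
          q ^ (n + 1) * (z ^ n + w ^ n) * (shiftDown u N (n + 1) * u (N + (n + 1)))) := by
  induction n with
  | zero =>
    have h := hu.shiftDown_mul_three_term_zero N
    simp [thetaCoeff_zero]
    linear_combination h + q ^ (2 * N) * (shiftDown u N 0 * u N) * (-hzw)
  | succ n ih =>
    have h := hu.shiftDown_mul_three_term N n
    rw [Finset.sum_range_succ, mul_add, ih, Finset.sum_range_succ _ (n + 1), thetaCoeff_succ,
      choose_two_succ n]
    generalize shiftDown u (N + 1) (n + 1) * u (N + 1 + (n + 1)) = c at *
    generalize shiftDown u N (n + 1) * u (N + (n + 1)) = c1 at *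
    generalize shiftDown u N n * u (N + n) = c0 at *
    have e2 : shiftDown u N (n + 1 + 1) * u (N + (n + 1 + 1)) =
      shiftDown u N (n + 2) * u (N + (n + 2)) := rfl
    rw [e2]
    generalize shiftDown u N (n + 2) * u (N + (n + 2)) = c2 at *
    subst hzw
    linear_combination ((-1) ^ (n + 1) * (z ^ (n + 1) + w ^ (n + 1)) * (z * w) ^ n.choose 2) * h

/-- The finite Jacobi triple product identity. -/
theorem sum_thetaCoeff {z w : R} (hzw : z * w = q) (N n : ℕ) (h : N ≤ n) :
    ∑ m ∈ Finset.range (n + 1), thetaCoeff z w q m * (shiftDown u N m * u (N + m)) =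
      u (2 * N) * (qPoch z q N * qPoch w q N) := by
  induction N generalizing n with
  | zero =>
    rw [Finset.sum_range_succ', Finset.sum_eq_zero]
    · simp [thetaCoeff_zero, shiftDown, hu.zero, qPoch_zero]
    · intro m _
      rw [shiftDown_of_lt u (by omega)]
      ring
  | succ N ih =>
    have h1 := hu.sum_thetaCoeff_aux hzw N n
    rw [ih n (by omega), shiftDown_of_lt u (by omega : N < n), shiftDown_of_lt u (by omega)] at h1
    apply hu.one_sub_cancel (2 * N)
    apply hu.one_sub_cancel (2 * N + 1)
    have e1 := hu.eq_mul_succ (2 * N)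
    have e2 := hu.eq_mul_succ (2 * N + 1)
    rw [e2] at e1
    rw [e1] at h1
    rw [qPoch_succ, qPoch_succ, show 2 * (N + 1) = 2 * N + 1 + 1 by ring]
    linear_combination h1

end IsInvQFactorial

end QSeries

section Limits

variable {R : Type*} [CommRing R]

theorem pow_eq_zero_of_pow_succ {q : R} {M e : ℕ} (hq : q ^ (M + 1) = 0) (h : M < e) :
    q ^ e = 0 := pow_eq_zero_of_le h hq

theorem qPoch_eq_of_le {a q : R} {n n' : ℕ} (h0 : a * q ^ n = 0) (h : n ≤ n') :
    qPoch a q n' = qPoch a q n := by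
  induction n', h using Nat.le_induction with
  | base => rfl
  | succ n' h ih =>
    obtain ⟨t, rfl⟩ := Nat.exists_eq_add_of_le h
    rw [qPoch_succ, ih, pow_add, ← mul_assoc, h0]
    ring

theorem qPoch_two_mul (q : R) (n : ℕ) :
    qPoch q q (2 * n) = qPoch q (q ^ 2) n * (qPoch (-q) q n * qPoch q q n) := by
  induction n with
  | zero => simp [qPoch_zero]
  | succ n ih =>
    rw [show 2 * (n + 1) = 2 * n + 1 + 1 by ring, qPoch_succ, qPoch_succ, ih]
    simp only [qPoch_succ]
    ring

theorem qPoch_five_mul (q : R) (n : ℕ) :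
    qPoch q q (5 * n) = qPoch q (q ^ 5) n * qPoch (q ^ 4) (q ^ 5) n *
      (qPoch (q ^ 2) (q ^ 5) n * qPoch (q ^ 3) (q ^ 5) n) * qPoch (q ^ 5) (q ^ 5) n := by
  induction n with
  | zero => simp [qPoch_zero]
  | succ n ih =>
    rw [show 5 * (n + 1) = 5 * n + 1 + 1 + 1 + 1 + 1 by ring]
    simp only [qPoch_succ, ih]
    ring

theorem two_mul_choose_two (n : ℕ) : 2 * n.choose 2 + n = n ^ 2 := by
  induction n with
  | zero => rfl
  | succ n ih => rw [choose_two_succ]; linarith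

/-- Summation over a triangle equals summation over a square if the rest contributes nothing. -/
theorem sum_range_antidiagonal {M : ℕ} (g : ℕ → ℕ → R) (hg : ∀ i j, M < i + j → g i j = 0) :
    ∑ n ∈ Finset.range (M + 1), ∑ p ∈ Finset.HasAntidiagonal.antidiagonal n, g p.1 p.2 =
      ∑ i ∈ Finset.range (M + 1), ∑ j ∈ Finset.range (M + 1), g i j := by
  symm
  rw [← Finset.sum_product', ← Finset.sum_filter_of_ne (p := fun p => p.1 + p.2 < M + 1),
    ← Finset.sum_fiberwise_of_maps_to (t := Finset.range (M + 1)) (g := fun p => p.1 + p.2)]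
  · refine Finset.sum_congr rfl fun n hn => Finset.sum_congr ?_ fun _ _ => rfl
    have := Finset.mem_range.1 hn
    ext p
    simp only [Finset.HasAntidiagonal.mem_antidiagonal, Finset.mem_filter, Finset.mem_product,
      Finset.mem_range]
    omega
  · intro p hp
    exact Finset.mem_range.2 (Finset.mem_filter.1 hp).2
  · intro p _ h
    by_contra h'
    exact h (hg _ _ (by omega))

namespace IsInvQFactorial

variable {q : R} {u : ℕ → R} (hu : IsInvQFactorial q u)
include hu

theorem mul_eq_of_le {x : R} {n n' : ℕ} (hx : x * q ^ (n + 1) = 0) (h : n ≤ n') :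
    x * u n = x * u n' := by
  induction n', h using Nat.le_induction with
  | base => rfl
  | succ n' h ih =>
    obtain ⟨t, rfl⟩ := Nat.exists_eq_add_of_le h
    rw [ih, hu.eq_mul_succ]
    have : x * q ^ (n + t + 1) = 0 := by
      rw [show n + t + 1 = n + 1 + t by ring, pow_add, ← mul_assoc, hx, zero_mul]
    linear_combination (-u (n + t + 1)) * this

theorem mul_shiftDown_mul {x : R} {M m : ℕ} (hm : m ≤ M) (hx : x * q ^ (M - m + 1) = 0) :
    x * (shiftDown u M m * u (M + m)) = x * (u M * u M) := by
  obtain ⟨t, rfl⟩ := Nat.exists_eq_add_of_le' hm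
  rw [Nat.add_sub_cancel] at hx
  have h1 := hu.mul_eq_of_le hx (Nat.le_add_right t m)
  have h2 : x * q ^ (t + m + 1) = 0 := by
    rw [show t + m + 1 = t + 1 + m by ring, pow_add, ← mul_assoc, hx, zero_mul]
  have h3 := hu.mul_eq_of_le h2 (Nat.le_add_right (t + m) m)
  rw [shiftDown_add]
  linear_combination u (t + m + m) * h1 - u (t + m) * h3

/-- Euler's identity `∑ q^(j(j+1)/2) / (q; q)_j = 1 / (q; q^2)_∞`, modulo `q^(M + 1)`. -/
theorem sum_mul_qPoch_euler {M : ℕ} (hq : q ^ (M + 1) = 0) :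
    (∑ j ∈ Finset.range (M + 1), q ^ (j + 1).choose 2 * u j) * qPoch q (q ^ 2) M = 1 := by
  have h := hu.sum_antidiagonal_qBinomial q M
  have h1 : ∑ p ∈ Finset.HasAntidiagonal.antidiagonal M,
      q ^ p.2.choose 2 * q ^ p.2 * u p.1 * u p.2 =
      u M * ∑ j ∈ Finset.range (M + 1), q ^ (j + 1).choose 2 * u j := by
    rw [Finset.Nat.sum_antidiagonal_eq_sum_range_succ_mk, ← Finset.sum_range_reflect,
      Finset.mul_sum]
    refine Finset.sum_congr rfl fun j hj => ?_
    have hj' := Finset.mem_range.1 hj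
    have e1 : M + 1 - 1 - j = M - j := by omega
    have e2 : M - (M - j) = j := by omega
    simp only [e1, e2, Nat.succ_eq_add_one]
    rw [← pow_add, hu.mul_eq_of_le (n' := M) _ (Nat.sub_le M j), choose_two_succ,
      add_comm j]
    · ring
    · rw [← pow_add]
      exact pow_eq_zero_of_pow_succ hq (by omega)
  rw [h1] at h
  rw [hu.mul_left_cancel M h]
  have h2 := qPoch_two_mul q M
  rw [qPoch_eq_of_le (by rw [← pow_succ', hq]) (by omega : M ≤ 2 * M)] at h2
  have h3 := hu.mul_qPoch M
  linear_combination (1 - qPoch (-q) q M * qPoch q (q ^ 2) M) * h3 - u M * h2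

/-- The first Rogers-Ramanujan identity, modulo `q^(M + 1)`. -/
theorem sum_mul_qPoch_rogersRamanujan {v : ℕ → R} (hv : IsInvQFactorial (q ^ 5) v) {M : ℕ}
    (hq : q ^ (M + 1) = 0) :
    (∑ s ∈ Finset.range (M + 1), q ^ (s ^ 2) * u s) *
      (qPoch q (q ^ 5) M * qPoch (q ^ 4) (q ^ 5) M) = 1 := by
  have h1 := hu.sum_range_rogersRamanujan M
  have h2 := hv.sum_thetaCoeff (show q ^ 2 * q ^ 3 = q ^ 5 by ring) M M le_rfl
  have e1 : ∑ s ∈ Finset.range (M + 1), q ^ (s ^ 2) * u (M - s) * u s =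
      u M * ∑ s ∈ Finset.range (M + 1), q ^ (s ^ 2) * u s := by
    rw [Finset.mul_sum]
    refine Finset.sum_congr rfl fun s hs => ?_
    rw [hu.mul_eq_of_le (n' := M) _ (Nat.sub_le M s)]
    · ring
    · rw [← pow_add]
      exact pow_eq_zero_of_pow_succ hq (by have := Nat.le_self_pow two_ne_zero s; omega)
  have e2 : ∀ m, q ^ (2 * m ^ 2) * thetaCoeff 1 q q m = thetaCoeff (q ^ 2) (q ^ 3) (q ^ 5) m := by
    intro m
    cases m with
    | zero => simp [thetaCoeff_zero]
    | succ m =>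
      have h := two_mul_choose_two (m + 1)
      have h' : q ^ (2 * (m + 1) ^ 2) = q ^ (4 * (m + 1).choose 2 + 2 * (m + 1)) := by
        congr 1; omega
      rw [h', thetaCoeff_succ, thetaCoeff_succ]
      ring
  have e3 : ∀ m e, M < m + e → thetaCoeff (q ^ 2) (q ^ 3) (q ^ 5) m * q ^ e = 0 := by
    intro m e he
    cases m with
    | zero => rw [pow_eq_zero_of_pow_succ (e := e) hq (by omega), mul_zero]
    | succ m =>
      have : q ^ (m + 1) * q ^ e = 0 := by
        rw [← pow_add]; exact pow_eq_zero_of_pow_succ hq he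
      rw [thetaCoeff_succ]
      linear_combination ((-1) ^ (m + 1) * (q ^ (m + 1) + q ^ (2 * (m + 1))) *
        (q ^ 5) ^ (m + 1).choose 2) * this
  have e4 : ∑ m ∈ Finset.range (M + 1),
      q ^ (2 * m ^ 2) * thetaCoeff 1 q q m * (shiftDown u M m * u (M + m)) =
      (∑ m ∈ Finset.range (M + 1), thetaCoeff (q ^ 2) (q ^ 3) (q ^ 5) m) * (u M * u M) := by
    rw [Finset.sum_mul]
    refine Finset.sum_congr rfl fun m hm => ?_
    have hm' := Finset.mem_range.1 hm
    rw [e2, hu.mul_shiftDown_mul (by omega) (e3 _ _ (by omega))]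
  have e5 : ∑ m ∈ Finset.range (M + 1),
      thetaCoeff (q ^ 2) (q ^ 3) (q ^ 5) m * (shiftDown v M m * v (M + m)) =
      (∑ m ∈ Finset.range (M + 1), thetaCoeff (q ^ 2) (q ^ 3) (q ^ 5) m) * (v M * v M) := by
    rw [Finset.sum_mul]
    refine Finset.sum_congr rfl fun m hm => ?_
    have hm' := Finset.mem_range.1 hm
    rw [hv.mul_shiftDown_mul (by omega) (by rw [← pow_mul]; exact e3 _ _ (by omega))]
  have e6 : v (2 * M) = v M := by
    have := hv.mul_eq_of_le (x := 1) (n := M) (n' := 2 * M)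
      (by rw [one_mul, ← pow_mul]; exact pow_eq_zero_of_pow_succ hq (by omega)) (by omega)
    linear_combination -this
  rw [e1, e4] at h1
  rw [e5, e6] at h2
  generalize ∑ m ∈ Finset.range (M + 1), thetaCoeff (q ^ 2) (q ^ 3) (q ^ 5) m = θ at h1 h2
  have h3 : ∑ s ∈ Finset.range (M + 1), q ^ (s ^ 2) * u s = u M * θ :=
    hu.mul_left_cancel M (by linear_combination h1)
  have h4 : v M * θ = qPoch (q ^ 2) (q ^ 5) M * qPoch (q ^ 3) (q ^ 5) M :=
    hv.mul_left_cancel M (by linear_combination h2)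
  have h5 := qPoch_five_mul q M
  rw [qPoch_eq_of_le (by rw [← pow_succ', hq]) (by omega : M ≤ 5 * M), ← h4] at h5
  have h6 := hu.mul_qPoch M
  have h7 := hv.mul_qPoch M
  rw [h3]
  linear_combination h6 - u M * h5 -
    u M * θ * (qPoch q (q ^ 5) M * qPoch (q ^ 4) (q ^ 5) M) * h7
end IsInvQFactorial

/-- The generating function of the members of `Γ` without the part `1` colored `R` that have `k`
parts colored `R` and `N` other parts. -/
def gammaTerm (q : R) (u : ℕ → R) (N k : ℕ) : R :=
  q ^ ((N + k + 1).choose 2 + k ^ 2) * u k * u N * qPoch (-q ^ k) q N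

/-- The analogue of `gammaTerm` for members of `Γ` that can be shifted behind a part `0` colored
`B`. -/
def gammaTermB (q : R) (u : ℕ → R) (N k : ℕ) : R :=
  q ^ ((N + k + 1).choose 2 + k ^ 2) * u k * u N * qPoch (-q ^ (k + 1)) q N

/-- The analogue of `gammaTerm` for members of `Γ` that can be put behind a part `0` colored
`G`. -/
def gammaTermG (q : R) (u : ℕ → R) (N k : ℕ) : R := q ^ k * gammaTermB q u N k

/-- Summation of a two-index family over a diagonal. -/
def diagSum (g : ℕ → ℕ → R) (n : ℕ) : R :=
  ∑ p ∈ Finset.HasAntidiagonal.antidiagonal n, g p.1 p.2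

theorem diagSum_congr {g g' : ℕ → ℕ → R} {n : ℕ} (h : ∀ i j, i + j = n → g i j = g' i j) :
    diagSum g n = diagSum g' n :=
  Finset.sum_congr rfl fun p hp => h p.1 p.2 (Finset.HasAntidiagonal.mem_antidiagonal.1 hp)

theorem diagSum_succ (g : ℕ → ℕ → R) (n : ℕ) :
    diagSum g (n + 1) = g 0 (n + 1) + diagSum (fun i j => g (i + 1) j) n :=
  Finset.Nat.sum_antidiagonal_succ

theorem diagSum_succ' (g : ℕ → ℕ → R) (n : ℕ) :
    diagSum g (n + 1) = g (n + 1) 0 + diagSum (fun i j => g i (j + 1)) n :=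
  Finset.Nat.sum_antidiagonal_succ'

theorem diagSum_add (g g' : ℕ → ℕ → R) (n : ℕ) :
    diagSum (fun i j => g i j + g' i j) n = diagSum g n + diagSum g' n :=
  Finset.sum_add_distrib

theorem diagSum_mul (c : R) (g : ℕ → ℕ → R) (n : ℕ) :
    diagSum (fun i j => c * g i j) n = c * diagSum g n :=
  (Finset.mul_sum _ _ _).symm

namespace IsInvQFactorial

variable {q : R} {u : ℕ → R} (hu : IsInvQFactorial q u)
include hu

theorem diagSum_gammaTerm_succ (n : ℕ) : diagSum (gammaTerm q u) (n + 1) =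
    diagSum (gammaTermB q u) (n + 1) + q ^ (n + 1) * diagSum (gammaTermG q u) n := by
  rw [diagSum_succ, diagSum_succ, ← diagSum_mul, add_assoc, ← diagSum_add]
  refine congrArg₂ (· + ·) ?_ ?_
  · simp [gammaTerm, gammaTermB, qPoch_zero]
  · refine diagSum_congr fun N k h => ?_
    subst h
    simp only [gammaTermG, gammaTerm, gammaTermB]
    rw [qPoch_succ', qPoch_succ, hu.eq_mul_succ N, show N + 1 + k + 1 = N + k + 1 + 1 by ring,
      choose_two_succ (N + k + 1), show -q ^ k * q = -q ^ (k + 1) by ring]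
    ring

theorem diagSum_gammaTermG_succ (n : ℕ) : diagSum (gammaTermG q u) (n + 1) =
    q ^ (n + 1) * (diagSum (gammaTerm q u) (n + 1) + diagSum (gammaTermG q u) n) := by
  rw [diagSum_succ, diagSum_succ, add_assoc, mul_add, ← diagSum_add, ← diagSum_mul]
  refine congrArg₂ (· + ·) ?_ ?_
  · simp [gammaTermG, gammaTerm, gammaTermB, qPoch_zero]
  · refine diagSum_congr fun N k h => ?_
    subst h
    simp only [gammaTermG, gammaTerm, gammaTermB]
    rw [qPoch_succ, qPoch_succ', hu.eq_mul_succ N, show N + 1 + k + 1 = N + k + 1 + 1 by ring,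
      choose_two_succ (N + k + 1), show -q ^ k * q = -q ^ (k + 1) by ring]
    ring

theorem diagSum_gammaTermB_succ (n : ℕ) : diagSum (gammaTermB q u) (n + 1) =
    q ^ (n + 1) * diagSum (gammaTermB q u) n + q ^ (n + 1) * diagSum (gammaTerm q u) (n + 1) +
      q ^ (2 * (n + 1)) * diagSum (gammaTermG q u) n := by
  have h : diagSum (gammaTermB q u) (n + 1) = diagSum (fun N k =>
      q ^ ((N + k).choose 2 + N + k + k ^ 2) * u k * ((1 - q ^ N) * u N) *
        qPoch (-q ^ (k + 1)) q (N - 1)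
      + q ^ (n + 1) * gammaTerm q u N k +
      q ^ (2 * (n + 1)) * (q ^ ((N + k).choose 2 + (k - 1) ^ 2 + (k - 1)) * ((1 - q ^ k) * u k) *
        u N * qPoch (-q ^ k) q N)) (n + 1) := by
    refine diagSum_congr fun N k h => ?_
    rw [← h]
    simp only [gammaTerm, gammaTermB, choose_two_succ]
    cases N with
    | zero =>
      cases k with
      | zero => omega
      | succ k =>
        simp only [qPoch_zero, Nat.add_sub_cancel]
        ring
    | succ N =>
      cases k with
      | zero =>
        simp only [Nat.add_sub_cancel]
        rw [qPoch_succ, qPoch_succ', show -q ^ 0 * q = -q ^ (0 + 1) by ring]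
        ring
      | succ k =>
        simp only [Nat.add_sub_cancel]
        rw [qPoch_succ, qPoch_succ', show -q ^ (k + 1) * q = -q ^ (k + 1 + 1) by ring]
        ring
  have h1 : diagSum (fun N k => q ^ ((N + k).choose 2 + N + k + k ^ 2) * u k *
      ((1 - q ^ N) * u N) * qPoch (-q ^ (k + 1)) q (N - 1)) (n + 1) =
      q ^ (n + 1) * diagSum (gammaTermB q u) n := by
    rw [diagSum_succ, ← diagSum_mul]
    simp only [pow_zero, sub_self, zero_mul, mul_zero, zero_add, Nat.add_sub_cancel,
      ← hu.eq_mul_succ]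
    refine diagSum_congr fun N k h => ?_
    rw [← h, gammaTermB, show N + 1 + k = N + k + 1 by ring]
    ring
  have h2 : diagSum (fun N k => q ^ ((N + k).choose 2 + (k - 1) ^ 2 + (k - 1)) *
      ((1 - q ^ k) * u k) * u N * qPoch (-q ^ k) q N) (n + 1) = diagSum (gammaTermG q u) n := by
    rw [diagSum_succ']
    simp only [pow_zero, sub_self, zero_mul, mul_zero, zero_add, Nat.add_sub_cancel,
      ← hu.eq_mul_succ]
    refine diagSum_congr fun N k h => ?_
    rw [gammaTermG, gammaTermB, show N + (k + 1) = N + k + 1 by ring]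
    ring
  rw [h, diagSum_add, diagSum_add, diagSum_mul, diagSum_mul, h1, h2]

theorem gammaTerm_eq_sum (N k : ℕ) : gammaTerm q u N k =
    ∑ p ∈ Finset.HasAntidiagonal.antidiagonal N,
      q ^ ((p.1 + k + 1).choose 2 + (p.2 + k) ^ 2 + p.1 * p.2) * u p.1 * u p.2 * u k := by
  have h := hu.sum_antidiagonal_qBinomial (q ^ k) N
  rw [gammaTerm, mul_assoc, ← h, Finset.mul_sum]
  refine Finset.sum_congr rfl fun p hp => ?_
  obtain rfl := Finset.HasAntidiagonal.mem_antidiagonal.1 hp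
  have e : (p.1 + p.2 + k + 1).choose 2 + k ^ 2 + p.2.choose 2 + k * p.2 =
      (p.1 + k + 1).choose 2 + (p.2 + k) ^ 2 + p.1 * p.2 := by
    have h1 := two_mul_choose_two (p.1 + p.2 + k + 1)
    have h2 := two_mul_choose_two (p.1 + k + 1)
    have h3 := two_mul_choose_two p.2
    nlinarith
  rw [← e]
  ring

theorem sum_diagSum_gammaTerm {M : ℕ} (hq : q ^ (M + 1) = 0) :
    ∑ n ∈ Finset.range (M + 1), diagSum (gammaTerm q u) n =
      (∑ j ∈ Finset.range (M + 1), q ^ (j + 1).choose 2 * u j) *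
        ∑ l ∈ Finset.range (M + 1), q ^ (l ^ 2) * u l := by
  have hsq : ∀ x : ℕ, x ≤ x ^ 2 := fun x => Nat.le_self_pow two_ne_zero x
  have hzero : ∀ a b k, M < a + b + k →
      q ^ ((a + k + 1).choose 2 + (b + k) ^ 2 + a * b) * u a * u b * u k = 0 := by
    intro a b k h
    rw [pow_eq_zero_of_pow_succ hq]
    · ring
    · have := hsq (b + k)
      rw [choose_two_succ]
      omega
  have hl : ∑ n ∈ Finset.range (M + 1), diagSum (gammaTerm q u) n =
      ∑ k ∈ Finset.range (M + 1), ∑ a ∈ Finset.range (M + 1), ∑ b ∈ Finset.range (M + 1),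
        q ^ ((a + k + 1).choose 2 + (b + k) ^ 2 + a * b) * u a * u b * u k := by
    simp only [diagSum]
    rw [sum_range_antidiagonal, Finset.sum_comm]
    · refine Finset.sum_congr rfl fun k _ => ?_
      rw [← sum_range_antidiagonal (fun a b =>
        q ^ ((a + k + 1).choose 2 + (b + k) ^ 2 + a * b) * u a * u b * u k)
        (fun a b h => hzero a b k (by omega))]
      exact Finset.sum_congr rfl fun N _ => hu.gammaTerm_eq_sum N k
    · intro N k h
      rw [hu.gammaTerm_eq_sum]
      refine Finset.sum_eq_zero fun p hp => hzero _ _ _ ?_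
      rw [Finset.HasAntidiagonal.mem_antidiagonal.1 hp]
      exact h
  have hr : (∑ j ∈ Finset.range (M + 1), q ^ (j + 1).choose 2 * u j) *
      ∑ l ∈ Finset.range (M + 1), q ^ (l ^ 2) * u l =
      ∑ l ∈ Finset.range (M + 1), ∑ k ∈ Finset.range (M + 1), ∑ a ∈ Finset.range (M + 1),
        q ^ ((k + a + 1).choose 2 + l ^ 2 + a * (l - k)) * u k * u a * shiftDown u l k := by
    rw [Finset.sum_mul_sum, Finset.sum_comm]
    refine Finset.sum_congr rfl fun l _ => ?_
    rw [← sum_range_antidiagonal]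
    · refine Finset.sum_congr rfl fun j _ => ?_
      calc _ = q ^ ((j + 1).choose 2 + l ^ 2) * (u j * u l) := by ring
        _ = _ := by
          rw [← hu.sum_antidiagonal_durfee, Finset.mul_sum]
          refine Finset.sum_congr rfl fun p hp => ?_
          rw [Finset.HasAntidiagonal.mem_antidiagonal.1 hp]
          ring
    · intro k a h
      rw [pow_eq_zero_of_pow_succ hq]
      · ring
      · rw [choose_two_succ]
        omega
  rw [hl, hr, Finset.sum_comm (s := Finset.range (M + 1)) (t := Finset.range (M + 1))
    (f := fun l k => ∑ a ∈ Finset.range (M + 1),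
        q ^ ((k + a + 1).choose 2 + l ^ 2 + a * (l - k)) * u k * u a * shiftDown u l k)]
  refine Finset.sum_congr rfl fun k hk => ?_
  rw [Finset.sum_comm]
  conv_rhs => rw [Finset.sum_comm]
  rw [Finset.sum_comm]
  refine Finset.sum_congr rfl fun a _ => ?_
  obtain ⟨t, rfl⟩ := Nat.exists_eq_add_of_le (Nat.lt_succ_iff.1 (Finset.mem_range.1 hk))
  conv_rhs => rw [add_assoc, Finset.sum_range_add]
  rw [Finset.sum_eq_zero (s := Finset.range k), zero_add]
  · rw [← Finset.sum_subset (s₁ := Finset.range (t + 1))]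
    · refine Finset.sum_congr rfl fun b _ => ?_
      rw [Nat.add_sub_cancel_left, add_comm k b, shiftDown_add, add_comm k a]
      ring
    · exact Finset.range_mono (by omega)
    · intro b _ hb
      exact hzero _ _ _ (by have := mt Finset.mem_range.2 hb; omega)
  · intro l h
    rw [shiftDown_of_lt u (Finset.mem_range.1 h), mul_zero]

end IsInvQFactorial

end Limits

section Combinatorics

/-- The least admissible difference between a part colored `c` and a larger part colored `d`. -/
def PartColor.minDiff : PartColor → PartColor → ℕ
  | .B, .R => 2
  | .B, .G => 2
  | .B, .B => 1
  | _, .R => 3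
  | _, .G => 1
  | _, .B => 2

theorem PartColor.minDiff_pos (c d : PartColor) : 0 < c.minDiff d := by
  cases c <;> cases d <;> simp [PartColor.minDiff]

/-- The finite multisets of colored parts that satisfy the conditions defining `Γ`, with sum `N`
and with every part of color `c` at least `t c`. -/
def gammaSet (t : PartColor → ℕ) (N : ℕ) : Set (Multiset (ℕ × PartColor)) :=
  {s | (s.map Prod.fst).Nodup ∧
    (∀ p ∈ s, ∀ p' ∈ s, p.1 < p'.1 → p.1 + p.2.minDiff p'.2 ≤ p'.1) ∧
    (∀ p ∈ s, t p.2 ≤ p.1) ∧ (s.map Prod.fst).sum = N}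

theorem ColoredPartition.inGamma_iff {n : ℕ} (π : ColoredPartition n) :
    π.InGamma ↔ (π.parts.map Prod.fst).Nodup ∧
      ∀ p ∈ π.parts, ∀ p' ∈ π.parts, p.1 < p'.1 → p.1 + p.2.minDiff p'.2 ≤ p'.1 := by
  constructor
  · intro h
    refine ⟨h.distinct, ?_⟩
    rintro ⟨j, c⟩ hp ⟨j', c'⟩ hp' hlt
    by_contra hcon
    obtain ⟨e, rfl⟩ := Nat.exists_eq_add_of_lt hlt
    have h1 := h.not_R_R_one j
    have h2 := h.not_R_R_two j
    have h3 := h.not_R_B_one j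
    have h4 := h.not_G_R_one j
    have h5 := h.not_G_R_two j
    have h6 := h.not_G_B_one j
    have h7 := h.not_B_R_one j
    have h8 := h.not_B_G_one j
    have he : e = 0 ∨ e = 1 ∨ 2 ≤ e := by omega
    rcases he with rfl | rfl | he
    · cases c <;> cases c' <;> simp_all [PartColor.minDiff]
    · cases c <;> cases c' <;> simp_all [PartColor.minDiff, add_assoc]
    · cases c <;> cases c' <;> simp only [PartColor.minDiff] at hcon <;> omega
  · rintro ⟨h1, h2⟩
    refine ⟨h1, ?_, ?_, ?_, ?_, ?_, ?_, ?_, ?_⟩ <;>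
    · rintro j ⟨hp, hp'⟩
      have := h2 _ hp _ hp' (by simp)
      simp [PartColor.minDiff] at this

theorem gammaSet_finite (t : PartColor → ℕ) (ht : ∀ d, 0 < t d) (N : ℕ) :
    (gammaSet t N).Finite := by
  refine (Set.finite_range (ColoredPartition.parts (n := N))).subset ?_
  rintro s ⟨-, -, h, hs⟩
  exact ⟨⟨s, fun p hp => (ht _).trans_le (h p hp), hs⟩, rfl⟩

theorem gammaSet_eq_union (t : PartColor → ℕ) (c : PartColor) (N : ℕ) (hle : ∀ d, t c ≤ t d)
    (hd : ∀ d, t d ≤ t c + c.minDiff d) :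
    gammaSet t N = gammaSet (Function.update t c (t c + 1)) N ∪
      {s | ∃ s', t c + (s'.map Prod.fst).sum = N ∧
        s' ∈ gammaSet (fun d => t c + c.minDiff d) (s'.map Prod.fst).sum ∧ (t c, c) ::ₘ s' = s} := by
  ext s
  constructor
  · rintro ⟨h1, h2, h3, h4⟩
    by_cases hm : (t c, c) ∈ s
    · right
      obtain ⟨s', rfl⟩ := Multiset.exists_cons_of_mem hm
      rw [Multiset.map_cons, Multiset.nodup_cons] at h1
      rw [Multiset.map_cons, Multiset.sum_cons] at h4
      refine ⟨s', h4, ⟨h1.2, fun p hp p' hp' => h2 p (Multiset.mem_cons_of_mem hp) p'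
        (Multiset.mem_cons_of_mem hp'), fun p hp => ?_, rfl⟩, rfl⟩
      refine h2 _ hm p (Multiset.mem_cons_of_mem hp) (lt_of_le_of_ne ?_ ?_)
      · exact (hle _).trans (h3 p (Multiset.mem_cons_of_mem hp))
      · intro he
        exact h1.1 (Multiset.mem_map.2 ⟨p, hp, he.symm⟩)
    · left
      refine ⟨h1, h2, ?_, h4⟩
      rintro ⟨j, d⟩ hp
      have := h3 _ hp
      by_cases hc : d = c
      · subst hc
        simp only [Function.update_self] at *
        refine Nat.succ_le_of_lt (lt_of_le_of_ne this ?_)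
        rintro rfl
        exact hm hp
      · simpa [Function.update_of_ne hc] using this
  · rintro (⟨h1, h2, h3, h4⟩ | ⟨s', hs, ⟨h1, h2, h3, -⟩, rfl⟩)
    · refine ⟨h1, h2, fun p hp => le_trans ?_ (h3 p hp), h4⟩
      by_cases hc : p.2 = c
      · simp [hc]
      · simp [Function.update_of_ne hc]
    · have hlt : ∀ p ∈ s', t c < p.1 := fun p hp =>
        (Nat.lt_add_of_pos_right (c.minDiff_pos p.2)).trans_le (h3 p hp)
      refine ⟨?_, ?_, ?_, ?_⟩
      · rw [Multiset.map_cons, Multiset.nodup_cons]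
        refine ⟨fun hmem => ?_, h1⟩
        obtain ⟨p, hp, he⟩ := Multiset.mem_map.1 hmem
        exact (hlt p hp).ne' he
      · intro p hp p' hp' hpp
        rcases Multiset.mem_cons.1 hp with rfl | hp <;> rcases Multiset.mem_cons.1 hp' with rfl | hp'
        · exact absurd hpp (lt_irrefl _)
        · exact h3 p' hp'
        · exact absurd hpp (hlt p hp).not_gt
        · exact h2 p hp p' hp' hpp
      · intro p hp
        rcases Multiset.mem_cons.1 hp with rfl | hp
        · exact le_rfl
        · exact (hd _).trans (h3 p hp)
      · rw [Multiset.map_cons, Multiset.sum_cons, hs]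

theorem ncard_gammaSet (t : PartColor → ℕ) (c : PartColor) (N : ℕ) (hpos : 0 < t c)
    (hle : ∀ d, t c ≤ t d) (hd : ∀ d, t d ≤ t c + c.minDiff d) :
    (gammaSet t N).ncard = (gammaSet (Function.update t c (t c + 1)) N).ncard +
      if t c ≤ N then (gammaSet (fun d => t c + c.minDiff d) (N - t c)).ncard else 0 := by
  rw [gammaSet_eq_union t c N hle hd]
  split_ifs with h
  · have himg : {s | ∃ s', t c + (s'.map Prod.fst).sum = N ∧
        s' ∈ gammaSet (fun d => t c + c.minDiff d) (s'.map Prod.fst).sum ∧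
          (t c, c) ::ₘ s' = s} =
        (fun s' => (t c, c) ::ₘ s') '' gammaSet (fun d => t c + c.minDiff d) (N - t c) := by
      ext s
      constructor
      · rintro ⟨s', h1, h2, rfl⟩
        exact ⟨s', by rwa [← h1, Nat.add_sub_cancel_left], rfl⟩
      · rintro ⟨s', h2, rfl⟩
        have h3 := h2.2.2.2
        exact ⟨s', by omega, by rwa [h3], rfl⟩
    have hfin : (gammaSet (Function.update t c (t c + 1)) N).Finite := by
      refine gammaSet_finite _ (fun d => ?_) _
      by_cases hc : d = c
      · simp [hc]
      · simpa [Function.update_of_ne hc] using hpos.trans_le (hle d)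
    have hinj : Function.Injective fun s' : Multiset (ℕ × PartColor) => (t c, c) ::ₘ s' :=
      fun a b hab => (Multiset.cons_inj_right _).1 hab
    rw [himg, Set.ncard_union_eq _ hfin ((gammaSet_finite _ (fun d => by omega) _).image _),
      Set.ncard_image_of_injective _ hinj]
    rw [Set.disjoint_left]
    rintro _ ⟨-, -, h3, -⟩ ⟨s', -, rfl⟩
    have := h3 _ (Multiset.mem_cons_self _ _)
    simp at this
  · rw [add_zero]
    congr 1
    refine Set.union_eq_left.2 ?_
    rintro _ ⟨s', h1, -⟩
    omega

theorem ncard_gammaSet_of_lt (t : PartColor → ℕ) (N : ℕ) (ht : ∀ d, N < t d) :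
    (gammaSet t N).ncard = if N = 0 then 1 else 0 := by
  have h : ∀ s ∈ gammaSet t N, s = 0 := by
    rintro s ⟨-, -, h3, h4⟩
    refine Multiset.eq_zero_of_forall_notMem fun p hp => ?_
    have h5 := Multiset.single_le_sum (s := s.map Prod.fst) (fun x _ => Nat.zero_le x) p.1
      (Multiset.mem_map_of_mem _ hp)
    have h6 := h3 p hp
    have h7 := ht p.2
    omega
  split_ifs with hN
  · rw [Set.ncard_eq_one]
    refine ⟨0, Set.eq_singleton_iff_unique_mem.2 ⟨?_, h⟩⟩
    simp [gammaSet, hN]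
  · rw [Set.ncard_eq_zero (gammaSet_finite t (fun d => (Nat.zero_le _).trans_lt (ht d)) N),
      Set.eq_empty_iff_forall_notMem]
    intro s hs
    obtain rfl := h s hs
    exact hN (by simpa using hs.2.2.2.symm)

/-- The function on colors with the given values. -/
def colorBounds (r g b : ℕ) : PartColor → ℕ
  | .R => r
  | .G => g
  | .B => b

/-- The number of members of `Γ` with sum `N`, with all parts colored `R` larger than `m + 1` and
all other parts larger than `m`. -/
noncomputable def gammaNum (m N : ℕ) : ℕ := (gammaSet (colorBounds (m + 2) (m + 1) (m + 1)) N).ncard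

/-- The number of members of `Γ` with sum `N` that can be put behind a part `m` colored `B`. -/
noncomputable def gammaNumB (m N : ℕ) : ℕ :=
  (gammaSet (colorBounds (m + 2) (m + 2) (m + 1)) N).ncard

/-- The number of members of `Γ` with sum `N` that can be put behind a part `m` colored `G`. -/
noncomputable def gammaNumG (m N : ℕ) : ℕ :=
  (gammaSet (colorBounds (m + 3) (m + 1) (m + 2)) N).ncard

theorem ncard_gammaSet_colorBounds (c : PartColor) {t t' t'' : PartColor → ℕ} (j N : ℕ)
    (hpos : 0 < j) (hc : t c = j) (hle : ∀ d, j ≤ t d ∧ t d ≤ j + c.minDiff d)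
    (ht' : ∀ d, t' d = if d = c then j + 1 else t d) (ht'' : ∀ d, t'' d = j + c.minDiff d) :
    (gammaSet t N).ncard = (gammaSet t' N).ncard +
      if j ≤ N then (gammaSet t'' (N - j)).ncard else 0 := by
  subst hc
  have e1 : t' = Function.update t c (t c + 1) := by
    funext d
    rw [ht', Function.update_apply]
  have e2 : t'' = fun d => t c + c.minDiff d := funext ht''
  rw [e1, e2]
  exact ncard_gammaSet t c N hpos (fun d => (hle d).1) (fun d => (hle d).2)

theorem gammaNum_eq (m N : ℕ) : gammaNum m N =
    gammaNumB m N + if m + 1 ≤ N then gammaNumG (m + 1) (N - (m + 1)) else 0 := by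
  refine ncard_gammaSet_colorBounds .G (m + 1) N m.succ_pos rfl ?_ ?_ ?_ <;>
  · intro d
    cases d <;> simp [colorBounds, PartColor.minDiff]

theorem gammaNumG_eq (m N : ℕ) : gammaNumG m N =
    gammaNum (m + 1) N + if m + 1 ≤ N then gammaNumG (m + 1) (N - (m + 1)) else 0 := by
  refine ncard_gammaSet_colorBounds .G (m + 1) N m.succ_pos rfl ?_ ?_ ?_ <;>
  · intro d
    cases d <;> simp [colorBounds, PartColor.minDiff]

theorem gammaNumB_eq (m N : ℕ) : gammaNumB m N =
    gammaNum (m + 1) N + (if m + 2 ≤ N then gammaNumG (m + 2) (N - (m + 2)) else 0) +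
      if m + 1 ≤ N then gammaNumB (m + 1) (N - (m + 1)) else 0 := by
  have h : (gammaSet (colorBounds (m + 2) (m + 2) (m + 2)) N).ncard = gammaNum (m + 1) N +
      if m + 2 ≤ N then gammaNumG (m + 2) (N - (m + 2)) else 0 := by
    refine ncard_gammaSet_colorBounds .R (m + 2) N (Nat.succ_pos _) rfl ?_ ?_ ?_ <;>
    · intro d
      cases d <;> simp [colorBounds, PartColor.minDiff]
  rw [← h]
  refine ncard_gammaSet_colorBounds .B (m + 1) N m.succ_pos rfl ?_ ?_ ?_ <;>
  · intro d
    cases d <;> simp [colorBounds, PartColor.minDiff]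

theorem gammaCount_eq (N : ℕ) : gammaCount N = gammaNum 0 N := by
  have hinj : Function.Injective (ColoredPartition.parts (n := N)) :=
    fun a b h => ColoredPartition.ext h
  rw [gammaCount, gammaNum]
  change Nat.card ↥{π : ColoredPartition N | π.InGamma ∧ (1, PartColor.R) ∉ π.parts} = _
  rw [Nat.card_coe_set_eq, ← Set.ncard_image_of_injective _ hinj]
  congr 1
  ext s
  constructor
  · rintro ⟨π, ⟨h1, h2⟩, rfl⟩
    obtain ⟨h3, h4⟩ := π.inGamma_iff.1 h1
    refine ⟨h3, h4, ?_, π.parts_sum⟩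
    rintro ⟨j, c⟩ hp
    have := π.parts_pos _ hp
    cases c with
    | R =>
      simp only [colorBounds] at *
      refine Nat.succ_le_of_lt (lt_of_le_of_ne this ?_)
      rintro rfl
      exact h2 hp
    | G => exact this
    | B => exact this
  · rintro ⟨h1, h2, h3, h4⟩
    refine ⟨⟨s, fun p hp => lt_of_lt_of_le ?_ (h3 p hp), h4⟩,
      ⟨(ColoredPartition.inGamma_iff _).2 ⟨h1, h2⟩, fun h => ?_⟩, rfl⟩
    · cases p.2 <;> simp [colorBounds]
    · simpa [colorBounds] using h3 _ h

end Combinatorics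

section GeneratingFunction

open PowerSeries

theorem map_qPoch {R S : Type*} [CommRing R] [CommRing S] (φ : R →+* S) (a q : R) (n : ℕ) :
    φ (qPoch a q n) = qPoch (φ a) (φ q) n := by
  simp [qPoch, map_prod]

theorem IsInvQFactorial.map {R S : Type*} [CommRing R] [CommRing S] (φ : R →+* S) {q : R}
    {u : ℕ → R} (hu : IsInvQFactorial q u) : IsInvQFactorial (φ q) (fun n => φ (u n)) where
  zero := by rw [hu.zero, map_one]
  eq_mul_succ n := by
    conv_lhs => rw [hu.eq_mul_succ n]
    simp

theorem map_diagSum_gammaTerm {R S : Type*} [CommRing R] [CommRing S] (φ : R →+* S) (q : R)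
    (u : ℕ → R) (n : ℕ) : φ (diagSum (gammaTerm q u) n) =
      diagSum (gammaTerm (φ q) (fun n => φ (u n))) n := by
  simp [diagSum, gammaTerm, map_sum, map_qPoch]

theorem constantCoeff_qPoch {q : ℚ⟦X⟧} (hq : constantCoeff q = 0) (n : ℕ) :
    constantCoeff (qPoch q q n) = 1 := by
  simp [qPoch, map_prod, hq]

theorem isInvQFactorial_inv {q : ℚ⟦X⟧} (hq : constantCoeff q = 0) :
    IsInvQFactorial q (fun n => (qPoch q q n)⁻¹) where
  zero := by simp [qPoch_zero]
  eq_mul_succ n := by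
    have h : ∀ n, constantCoeff (qPoch q q n) ≠ 0 := fun n => by
      rw [constantCoeff_qPoch hq]; exact one_ne_zero
    rw [PowerSeries.inv_eq_iff_mul_eq_one (h n)]
    have := PowerSeries.mul_inv_cancel _ (h (n + 1))
    rw [qPoch_succ] at this ⊢
    linear_combination this

/-- The truncated sum `∑ x_n q^(m n)`. -/
noncomputable def truncSeries (x : ℕ → ℚ⟦X⟧) (M m : ℕ) : ℚ⟦X⟧ :=
  ∑ n ∈ Finset.range (M + 1), X ^ (m * n) * x n

theorem truncSeries_succ (x : ℕ → ℚ⟦X⟧) (M m : ℕ) :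
    truncSeries x (M + 1) m =
      x 0 + ∑ n ∈ Finset.range (M + 1), X ^ (m * (n + 1)) * x (n + 1) := by
  rw [truncSeries, Finset.sum_range_succ', mul_zero, pow_zero, one_mul, add_comm]

theorem coeff_truncSeries {x : ℕ → ℚ⟦X⟧} (h0 : x 0 = 1) (hx : ∀ n, X ^ (n + 1) ∣ x (n + 1))
    {M m N : ℕ} (h : N ≤ m) : coeff N (truncSeries x M m) = if N = 0 then 1 else 0 := by
  rw [truncSeries, Finset.sum_range_succ', map_add, map_sum, Finset.sum_eq_zero, h0]
  · simp [coeff_one]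
  · intro n _
    obtain ⟨y, hy⟩ := hx n
    rw [hy, ← mul_assoc, ← pow_add, coeff_X_pow_mul', if_neg]
    nlinarith

variable {u : ℕ → ℚ⟦X⟧} (hu : IsInvQFactorial X u)
include hu

theorem coeff_truncSeries_gammaTerm (d : ℕ) : ∀ m N M, N ≤ m + d → N ≤ M →
    coeff N (truncSeries (diagSum (gammaTerm X u)) M m) = gammaNum m N ∧
    coeff N (truncSeries (diagSum (gammaTermB X u)) M m) = gammaNumB m N ∧
    coeff N (truncSeries (diagSum (gammaTermG X u)) M m) = gammaNumG m N := by
  have z1 : diagSum (gammaTerm X u) 0 = 1 := by simp [diagSum, gammaTerm, hu.zero, qPoch_zero]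
  have z2 : diagSum (gammaTermB X u) 0 = 1 := by simp [diagSum, gammaTermB, hu.zero, qPoch_zero]
  have z3 : diagSum (gammaTermG X u) 0 = 1 := by
    simp [diagSum, gammaTermB, gammaTermG, hu.zero, qPoch_zero]
  have base : ∀ m N M, N ≤ m →
      coeff N (truncSeries (diagSum (gammaTerm X u)) M m) = gammaNum m N ∧
      coeff N (truncSeries (diagSum (gammaTermB X u)) M m) = gammaNumB m N ∧
      coeff N (truncSeries (diagSum (gammaTermG X u)) M m) = gammaNumG m N := by
    intro m N M h
    have d2 : ∀ n, X ^ (n + 1) ∣ diagSum (gammaTermB X u) (n + 1) := fun n => by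
      rw [hu.diagSum_gammaTermB_succ, two_mul, pow_add]
      exact Dvd.intro (diagSum (gammaTermB X u) n + diagSum (gammaTerm X u) (n + 1) +
        X ^ (n + 1) * diagSum (gammaTermG X u) n) (by ring)
    have d1 : ∀ n, X ^ (n + 1) ∣ diagSum (gammaTerm X u) (n + 1) := fun n => by
      rw [hu.diagSum_gammaTerm_succ]
      exact (d2 n).add (dvd_mul_right _ _)
    have d3 : ∀ n, X ^ (n + 1) ∣ diagSum (gammaTermG X u) (n + 1) := fun n => by
      rw [hu.diagSum_gammaTermG_succ]
      exact dvd_mul_right _ _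
    rw [coeff_truncSeries z1 d1 h, coeff_truncSeries z2 d2 h, coeff_truncSeries z3 d3 h,
      gammaNum, gammaNumB, gammaNumG, ncard_gammaSet_of_lt, ncard_gammaSet_of_lt,
      ncard_gammaSet_of_lt]
    · simp
    all_goals
      intro c
      cases c <;> simp only [colorBounds] <;> omega
  induction d with
  | zero => exact fun m N M h _ => base m N M h
  | succ d ih =>
    intro m N M hN hM
    cases M with
    | zero => exact base m N 0 (by omega)
    | succ M =>
      have r1 : truncSeries (diagSum (gammaTerm X u)) (M + 1) m =
          truncSeries (diagSum (gammaTermB X u)) (M + 1) m +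
            X ^ (m + 1) * truncSeries (diagSum (gammaTermG X u)) M (m + 1) := by
        rw [truncSeries_succ, truncSeries_succ, truncSeries, Finset.mul_sum, z1, z2, add_assoc,
          ← Finset.sum_add_distrib]
        congr 1
        refine Finset.sum_congr rfl fun n _ => ?_
        rw [hu.diagSum_gammaTerm_succ]
        ring
      have r3 : truncSeries (diagSum (gammaTermG X u)) (M + 1) m =
          truncSeries (diagSum (gammaTerm X u)) (M + 1) (m + 1) +
            X ^ (m + 1) * truncSeries (diagSum (gammaTermG X u)) M (m + 1) := by
        rw [truncSeries_succ, truncSeries_succ, truncSeries, Finset.mul_sum, z1, z3, add_assoc,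
          ← Finset.sum_add_distrib]
        congr 1
        refine Finset.sum_congr rfl fun n _ => ?_
        rw [hu.diagSum_gammaTermG_succ]
        ring
      have r2 : truncSeries (diagSum (gammaTermB X u)) (M + 1) m =
          truncSeries (diagSum (gammaTerm X u)) (M + 1) (m + 1) +
            X ^ (m + 2) * truncSeries (diagSum (gammaTermG X u)) M (m + 2) +
            X ^ (m + 1) * truncSeries (diagSum (gammaTermB X u)) M (m + 1) := by
        rw [truncSeries_succ, truncSeries_succ, truncSeries, truncSeries, Finset.mul_sum,
          Finset.mul_sum, z1, z2, add_assoc, add_assoc, ← Finset.sum_add_distrib,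
          ← Finset.sum_add_distrib]
        congr 1
        refine Finset.sum_congr rfl fun n _ => ?_
        rw [hu.diagSum_gammaTermB_succ]
        ring
      have h3 : coeff N (truncSeries (diagSum (gammaTermG X u)) (M + 1) m) = gammaNumG m N := by
        rw [r3, gammaNumG_eq, map_add, coeff_X_pow_mul', (ih (m + 1) N (M + 1) (by omega) hM).1]
        split_ifs with h
        · rw [(ih (m + 1) _ M (by omega) (by omega)).2.2, Nat.cast_add]
        · simp
      have h2 : coeff N (truncSeries (diagSum (gammaTermB X u)) (M + 1) m) = gammaNumB m N := by
        rw [r2, gammaNumB_eq, map_add, map_add, coeff_X_pow_mul', coeff_X_pow_mul',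
          (ih (m + 1) N (M + 1) (by omega) hM).1, Nat.cast_add, Nat.cast_add]
        congr 1
        · congr 1
          split_ifs with h
          · exact (ih (m + 2) _ M (by omega) (by omega)).2.2
          · simp
        · split_ifs with h
          · exact (ih (m + 1) _ M (by omega) (by omega)).2.1
          · simp
      refine ⟨?_, h2, h3⟩
      rw [r1, gammaNum_eq, map_add, coeff_X_pow_mul', h2]
      split_ifs with h
      · rw [(ih (m + 1) _ M (by omega) (by omega)).2.2, Nat.cast_add]
      · simp

theorem X_pow_dvd_mk_gammaCount_sub (M : ℕ) :
    X ^ (M + 1) ∣ PowerSeries.mk (fun n : ℕ => (gammaCount n : ℚ)) -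
      ∑ n ∈ Finset.range (M + 1), diagSum (gammaTerm X u) n := by
  rw [X_pow_dvd_iff]
  intro N hN
  have h := (coeff_truncSeries_gammaTerm hu N 0 N M (by omega) (by omega)).1
  simp only [truncSeries, zero_mul, pow_zero, one_mul] at h
  rw [map_sub, coeff_mk, h, gammaCount_eq, sub_self]

end GeneratingFunction

section InfiniteProduct

open PowerSeries

theorem X_pow_dvd_qPochhammerInf_sub {k m : ℕ} (hk : 0 < k) (hm : 0 < m) (M : ℕ) :
    (X : ℚ⟦X⟧) ^ (M + 1) ∣ qPochhammerInf (X ^ k) (X ^ m) - qPoch (X ^ k) (X ^ m) M := by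
  have hstable : ∀ n, M ≤ n →
      (X : ℚ⟦X⟧) ^ (M + 1) ∣ qPoch (X ^ k) (X ^ m) n - qPoch (X ^ k) (X ^ m) M := by
    intro n hn
    induction n, hn using Nat.le_induction with
    | base => simp
    | succ n hn ih =>
      have h : (X : ℚ⟦X⟧) ^ (M + 1) ∣ X ^ k * (X ^ m) ^ n := by
        rw [← pow_mul, ← pow_add]
        exact pow_dvd_pow _ (by nlinarith)
      rw [qPoch_succ]
      have := ih.sub (h.mul_left (qPoch (X ^ k) (X ^ m) n))
      convert this using 1
      ring
  rw [X_pow_dvd_iff]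
  intro d hd
  have h1 := (hasProd_qPochhammerInf k m hm).tendsto_prod_nat
  have h2 := (PowerSeries.WithPiTopology.continuous_coeff ℚ d).tendsto
    (qPochhammerInf (X ^ k) (X ^ m)) |>.comp h1
  have h3 : Filter.Tendsto (fun n => coeff d (qPoch (X ^ k : ℚ⟦X⟧) (X ^ m) n)) Filter.atTop
      (nhds (coeff d (qPoch (X ^ k : ℚ⟦X⟧) (X ^ m) M))) := by
    refine tendsto_const_nhds.congr' ?_
    filter_upwards [Filter.eventually_ge_atTop M] with n hn
    have := X_pow_dvd_iff.1 (hstable n hn) d hd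
    rw [map_sub] at this
    linarith
  rw [map_sub, tendsto_nhds_unique h2 h3, sub_self]

end InfiniteProduct

theorem theorem1 :
    PowerSeries.mk (fun n : ℕ => (gammaCount n : ℚ)) =
      (qPochhammerInf PowerSeries.X (PowerSeries.X ^ 2) *
        (qPochhammerInf PowerSeries.X (PowerSeries.X ^ 5) *
          qPochhammerInf (PowerSeries.X ^ 4) (PowerSeries.X ^ 5)))⁻¹ := by
  have c1 := constantCoeff_qPochhammerInf 1 2 one_pos two_pos
  have c2 := constantCoeff_qPochhammerInf 1 5 one_pos (by norm_num)
  have c3 := constantCoeff_qPochhammerInf 4 5 (by norm_num) (by norm_num)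
  rw [pow_one] at c1 c2
  rw [PowerSeries.eq_inv_iff_mul_eq_one (by simp [c1, c2, c3])]
  ext M
  have hu : IsInvQFactorial (PowerSeries.X : ℚ⟦X⟧) _ := isInvQFactorial_inv (by simp)
  have hv : IsInvQFactorial ((PowerSeries.X : ℚ⟦X⟧) ^ 5) _ := isInvQFactorial_inv (by simp)
  let φ := Ideal.Quotient.mk (Ideal.span {(PowerSeries.X : ℚ⟦X⟧) ^ (M + 1)})
  have hφ : ∀ {a b : ℚ⟦X⟧}, PowerSeries.X ^ (M + 1) ∣ a - b → φ a = φ b := fun h =>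
    Ideal.Quotient.eq.2 (Ideal.mem_span_singleton.2 h)
  have hq : φ PowerSeries.X ^ (M + 1) = 0 := by
    rw [← map_pow]
    exact Ideal.Quotient.eq_zero_iff_mem.2 (Ideal.mem_span_singleton_self _)
  have p1 := hφ (X_pow_dvd_qPochhammerInf_sub one_pos two_pos M)
  have p2 := hφ (X_pow_dvd_qPochhammerInf_sub one_pos (by norm_num : 0 < 5) M)
  have p3 := hφ (X_pow_dvd_qPochhammerInf_sub (by norm_num : 0 < 4) (by norm_num : 0 < 5) M)
  rw [pow_one, map_qPoch, map_pow] at p1 p2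
  rw [map_qPoch, map_pow, map_pow] at p3
  have hv' := hv.map φ
  rw [map_pow] at hv'
  have r1 := (hu.map φ).sum_mul_qPoch_euler hq
  have r2 := (hu.map φ).sum_mul_qPoch_rogersRamanujan hv' hq
  have h : φ (PowerSeries.mk (fun n : ℕ => (gammaCount n : ℚ)) *
      (qPochhammerInf PowerSeries.X (PowerSeries.X ^ 2) *
        (qPochhammerInf PowerSeries.X (PowerSeries.X ^ 5) *
          qPochhammerInf (PowerSeries.X ^ 4) (PowerSeries.X ^ 5)))) = φ 1 := by
    rw [map_mul, map_mul, map_mul, p1, p2, p3, hφ (X_pow_dvd_mk_gammaCount_sub hu M), map_sum]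
    simp_rw [map_diagSum_gammaTerm]
    rw [(hu.map φ).sum_diagSum_gammaTerm hq, map_one, mul_mul_mul_comm, r1, r2, one_mul]
  have hd := Ideal.mem_span_singleton.1 (Ideal.Quotient.eq.1 h)
  have := PowerSeries.X_pow_dvd_iff.1 hd M (Nat.lt_succ_self M)
  rw [map_sub] at this
  linarith
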